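/- A \emph{graph} is a set $G$ with an arbitrary binary relation $E(G)\subseteq G\times G$ (loops and symmetric pairs are allowed); homomorphisms are the edge-preserving maps. A graph is \emph{well-founded} if every non-empty set $S$ of vertices contains some $s$ such that there is no edge $(p,s)$ with $p\in S$ (in particular the graph is a directed graph without directed cycles). Let $\mathbf{WGra}$ be the category of well-founded graphs with homomorphisms. For a (finitary, purely functional) similarity type $\Delta$, let $\mathbf{Alg}(\Delta)$ be the category of universal algebras of type $\Delta$ with homomorphisms; for a category $\mathfrak C$ of structures and a cardinal $\kappa$ let $\mathfrak C_{<\kappa}$ be its full subcategory on the objects of size $<\kappa$. A category $\mathfrak C$ is \emph{algebraically universal} if for every similarity type $\Delta$ there is a fully faithful functor $\mathbf{Alg}(\Delta)\to\mathfrak C$. For an infinite cardinal $\kappa$, it is \emph{$\kappa$-universal} if for every similarity type $\Delta$ with $|\Delta|<\kappa$ there is a fully faithful functor $\mathbf{Alg}(\Delta)_{<\kappa}\to\mathfrak C_{<\kappa}$. Let $\mathcal H$ be the directed graph with vertices $s,t,0,1,2$ and edges $2\to s,\ 2\to 1,\ 2\to t,\ s\to 0,\ 0\to 1,\ t\to 1$.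 For a graph $G$, let $G\star\mathcal H$ be the graph with vertex set $G\sqcup\bigl(E(G)\times\{0,1,2\}\bigr)$ whose edges are the images of the edges of $\mathcal H$ under the maps $\phi_{(u,v)}$, $(u,v)\in E(G)$, where $\phi_{(u,v)}(s)=u$, $\phi_{(u,v)}(t)=v$ and $\phi_{(u,v)}(x)=(u,v,x)$ for $x\in\{0,1,2\}$. For a homomorphism $f:G\to G'$ let $f\star\mathcal H$ be given by $u\mapsto f(u)$ and $(u,v,x)\mapsto(f(u),f(v),x)$. \textbf{Corollary.} The category $\mathbf{WGra}$ is algebraically universal, and it is $\kappa$-universal for every infinite cardinal $\kappa$. Moreover, $G\mapsto G\star\mathcal H$, $f\mapsto f\star\mathcal H$ is a full and faithful functor to $\mathbf{WGra}$ from the category of connected graphs with at least one edge (connected meaning that the underlying undirected graph is connected), with homomorphisms, and for every infinite $\kappa$ it sends graphs of size $<\kappa$ to graphs of size $<\kappa$. -/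

import Mathlib

open CategoryTheory

universe u v w

/-! ### Universal algebras -/

/-- A universal algebra of type `Δ`, with carrier in `Type u`. Here `Δ` is a first-order language,
used below only when it has no relation symbols. -/
structure UAlg (Δ : FirstOrder.Language.{u, u}) : Type (u + 1) where
  carrier : Type u
  [str : Δ.Structure carrier]

attribute [instance] UAlg.str

/-- The category `Alg(Δ)`: homomorphisms are the maps commuting with all operations. -/
instance UAlg.category (Δ : FirstOrder.Language.{u, u}) : Category.{u} (UAlg Δ) where
  Hom A B := FirstOrder.Language.Hom Δ A.carrier B.carrier
  id A := FirstOrder.Language.Hom.id Δ A.carrier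
  comp f g := g.comp f

instance UAlg.concreteCategory (Δ : FirstOrder.Language.{u, u}) :
    ConcreteCategory (UAlg Δ) (fun A B => FirstOrder.Language.Hom Δ A.carrier B.carrier) where
  hom f := f
  ofHom f := f
  hom_ofHom _ := rfl
  ofHom_hom _ := rfl
  id_apply _ := rfl
  comp_apply _ _ _ := rfl

/-! ### Universality -/

/-- A category is algebraically universal if every category of universal algebras (of finitary
type) has a fully faithful functor into it. -/
def AlgebraicallyUniversal (C : Type v) [Category.{w} C] : Prop :=
  ∀ (Δ : FirstOrder.Language.{u, u}) [Δ.IsAlgebraic],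
    ∃ Φ : UAlg Δ ⥤ C, Φ.Full ∧ Φ.Faithful

section Size

variable (C : Type v) [Category.{w} C] {FC : C → C → Type*} {CC : C → Type u}
  [∀ X Y, FunLike (FC X Y) (CC X) (CC Y)] [ConcreteCategory C FC]

/-- The objects of size `< κ` of a concrete category. -/
def sizeLT (κ : Cardinal.{u}) : ObjectProperty C := fun X => Cardinal.mk (ToType X) < κ

/-- The full subcategory `C_{<κ}` of the objects of size `< κ`. -/
abbrev SizeLT (κ : Cardinal.{u}) := (sizeLT C κ).FullSubcategory

/-- `κ`-universality: for every similarity type `Δ` with fewer than `κ` operation symbols, there is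
a fully faithful functor from `Alg(Δ)_{<κ}` to `C_{<κ}`. -/
def KappaUniversal (κ : Cardinal.{u}) : Prop :=
  ∀ (Δ : FirstOrder.Language.{u, u}) [Δ.IsAlgebraic], Δ.card < κ →
    ∃ Φ : SizeLT (UAlg Δ) κ ⥤ SizeLT C κ, Φ.Full ∧ Φ.Faithful

end Size

/-! ### Graphs -/

/-- A graph: a set with an arbitrary binary relation (loops and symmetric pairs of edges are
allowed). -/
structure Gra : Type (u + 1) where
  V : Type u
  graph : Digraph V

/-- The edge relation. -/
abbrev Gra.Adj (G : Gra.{u}) : G.V → G.V → Prop := G.graph.Adj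

/-- The category of graphs: homomorphisms are the edge-preserving maps. -/
instance Gra.category : Category.{u} Gra.{u} where
  Hom G H := G.Adj →r H.Adj
  id G := RelHom.id G.Adj
  comp f g := g.comp f

instance Gra.concreteCategory :
    ConcreteCategory Gra.{u} (fun G H => G.Adj →r H.Adj) where
  hom f := f
  ofHom f := f
  hom_ofHom _ := rfl
  ofHom_hom _ := rfl
  id_apply _ := rfl
  comp_apply _ _ _ := rfl

/-- A graph is well-founded if every non-empty set `S` of vertices has an element `s` such that
there is no edge from an element of `S` to `s`. -/
def Gra.wellFounded : ObjectProperty Gra.{u} :=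
  fun G => ∀ S : Set G.V, S.Nonempty → ∃ s ∈ S, ∀ p ∈ S, ¬ G.Adj p s

theorem Gra.wellFounded_iff (G : Gra.{u}) : Gra.wellFounded G ↔ WellFounded G.Adj := by
  rw [WellFounded.wellFounded_iff_has_min]
  rfl

/-- Well-founded graphs have no directed cycles (in particular no loops). -/
theorem Gra.wellFounded.acyclic {G : Gra.{u}} (h : Gra.wellFounded G) (x : G.V) :
    ¬ Relation.TransGen G.Adj x x :=
  fun hx => (((Gra.wellFounded_iff G).1 h).transGen).irrefl.irrefl x hx

/-- The category of well-founded graphs. -/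
abbrev WGra := (Gra.wellFounded.{u}).FullSubcategory

/-- A connected graph with at least one edge: the underlying undirected graph is connected, and
there is an edge (possibly a loop). -/
def Gra.connected : ObjectProperty Gra.{u} :=
  fun G => G.graph.toSimpleGraphInclusive.Connected ∧ ∃ x y, G.Adj x y

/-- The category of connected graphs with at least one edge. -/
abbrev ConGra := (Gra.connected.{u}).FullSubcategory

/-! ### Simple graph gadgets and the construction `G ⋆ M` -/

/-- A simple graph gadget `(M, α, β)`. -/
structure SimpleGadget : Type (w + 1) where
  V : Type w
  graph : Digraph V
  α : V
  β : V
  ne : α ≠ β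

namespace SimpleGadget

/-- The edge set of a graph. -/
abbrev Edge (G : Gra.{u}) : Type u := {e : G.V × G.V // G.Adj e.1 e.2}

/-- The vertices of a gadget other than the two distinguished ones. -/
abbrev Inner (M : SimpleGadget.{w}) : Type w := {x : M.V // x ≠ M.α ∧ x ≠ M.β}

/-- The vertex set of `G ⋆ M`: the vertices of `G`, and for each edge of `G` a copy of the vertices
of `M` other than `α` and `β`. -/
abbrev StarV (G : Gra.{u}) (M : SimpleGadget.{w}) : Type (max u w) :=
  G.V ⊕ (Edge G × M.Inner)

open Classical in
/-- The map `M → G ⋆ M` associated with an edge `(u, v)` of `G`: it sends `α` to `u`, `β` to `v`,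
and any other `x` to the copy `(u, v, x)`. -/
noncomputable def phi (G : Gra.{u}) (M : SimpleGadget.{w}) (e : Edge G) (x : M.V) : StarV G M :=
  if hα : x = M.α then Sum.inl e.1.1
  else if hβ : x = M.β then Sum.inl e.1.2
  else Sum.inr (e, ⟨x, hα, hβ⟩)

/-- The graph `G ⋆ M`: its edges are the images of the edges of `M` under the maps `phi`. -/
def star (G : Gra.{u}) (M : SimpleGadget.{w}) : Gra.{max u w} where
  V := StarV G M
  graph := { Adj := fun a b => ∃ (e : Edge G) (x y : M.V),
    M.graph.Adj x y ∧ phi G M e x = a ∧ phi G M e y = b }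

/-- The action of a graph homomorphism on edges. -/
def mapEdge {G H : Gra.{u}} (f : G ⟶ H) (e : Edge G) : Edge H :=
  ⟨(ConcreteCategory.hom f e.1.1, ConcreteCategory.hom f e.1.2),
    (ConcreteCategory.hom f).map_rel e.2⟩

/-- The underlying map of `f ⋆ M`. -/
def starMapFun {G H : Gra.{u}} (f : G ⟶ H) (M : SimpleGadget.{w}) : StarV G M → StarV H M :=
  Sum.map (ConcreteCategory.hom f) (Prod.map (mapEdge f) id)

theorem starMapFun_phi {G H : Gra.{u}} (f : G ⟶ H) (M : SimpleGadget.{w}) (e : Edge G) (x : M.V) :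
    starMapFun f M (phi G M e x) = phi H M (mapEdge f e) x := by
  unfold phi
  split_ifs <;> rfl

/-- The homomorphism `f ⋆ M : G ⋆ M → H ⋆ M`. -/
def starMap {G H : Gra.{u}} (f : G ⟶ H) (M : SimpleGadget.{w}) : star G M ⟶ star H M :=
  ConcreteCategory.ofHom (C := Gra.{max u w}) (X := star G M) (Y := star H M)
    { toFun := starMapFun f M
      map_rel' := by
        rintro _ _ ⟨e, x, y, hxy, rfl, rfl⟩
        exact ⟨mapEdge f e, x, y, hxy, (starMapFun_phi f M e x).symm,
          (starMapFun_phi f M e y).symm⟩ }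

/-- The functor `- ⋆ M` from graphs to graphs. -/
def starFunctor (M : SimpleGadget.{w}) : Gra.{u} ⥤ Gra.{max u w} where
  obj G := star G M
  map f := starMap f M
  map_id G := by
    apply RelHom.ext
    rintro (x | ⟨e, c⟩) <;> rfl
  map_comp f g := by
    apply RelHom.ext
    rintro (x | ⟨e, c⟩) <;> rfl

end SimpleGadget

/-! ### The gadget `ℋ` -/

/-- The five vertices of `ℋ`. -/
inductive HVertex : Type
  | s | t | zero | one | two
  deriving DecidableEq

instance : Fintype HVertex where
  elems := {.s, .t, .zero, .one, .two}
  complete x := by cases x <;> decide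

/-- The six edges of `ℋ`. -/
inductive HAdj : HVertex → HVertex → Prop
  | two_s : HAdj .two .s
  | two_one : HAdj .two .one
  | two_t : HAdj .two .t
  | s_zero : HAdj .s .zero
  | zero_one : HAdj .zero .one
  | t_one : HAdj .t .one

/-- The simple graph gadget `(ℋ, s, t)`. -/
def gadgetH : SimpleGadget.{0} where
  V := HVertex
  graph := { Adj := HAdj }
  α := .s
  β := .t
  ne := by decide

/-- The length of a longest directed path of `ℋ` ending in a given vertex. -/
def HVertex.height : HVertex → ℕ
  | .two => 0
  | .s => 1
  | .t => 1
  | .zero => 2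
  | .one => 3

theorem star_gadgetH_wellFounded (G : Gra.{u}) :
    Gra.wellFounded (SimpleGadget.star G gadgetH) := by
  rw [Gra.wellFounded_iff]
  let ht : SimpleGadget.StarV G gadgetH → ℕ :=
    Sum.elim (fun _ => 1) (fun p => HVertex.height p.2.1)
  have key : ∀ (e : SimpleGadget.Edge G) (x : HVertex),
      ht (SimpleGadget.phi G gadgetH e x) = x.height := by
    intro e x
    unfold SimpleGadget.phi
    split_ifs with h1 h2
    · subst h1; rfl
    · subst h2; rfl
    · rfl
  refine Subrelation.wf (r := InvImage (· < ·) ht) ?_ (InvImage.wf ht wellFounded_lt)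
  rintro _ _ ⟨e, x, y, hxy, rfl, rfl⟩
  have hlt : x.height < y.height := by cases hxy <;> decide
  rw [← key e x, ← key e y] at hlt
  exact hlt

/-- The functor `G ↦ G ⋆ ℋ`, `f ↦ f ⋆ ℋ` from connected graphs (with at least one edge) to
well-founded graphs. -/
def starH : ConGra.{u} ⥤ WGra.{u} :=
  Gra.wellFounded.lift (Gra.connected.ι ⋙ SimpleGadget.starFunctor gadgetH)
    (fun G => star_gadgetH_wellFounded G.obj)

/-!
Every category `Alg(Δ)` is embedded into connected graphs by `algToConGra`, and the functor `starH`
then makes the graphs well-founded. Both functors are full and faithful and respect sizes.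

In `G ⋆ ℋ` every edge increases the height, and heights run from `0` to `3`. The path
`2 → s → 0 → 1` in a copy of `ℋ` has length `3`, so a homomorphism `G ⋆ ℋ → G' ⋆ ℋ` preserves heights
along it, and the remaining edges of `ℋ` force each copy of `ℋ` to go onto a copy of `ℋ`, label by
label (`SimpleGadget.hom_star_edge`). As no vertex of a connected graph with an edge is isolated,
such a homomorphism is induced by a homomorphism `G → G'`.

An algebra `A` is coded by a vertex for each element, a vertex for each pair `t = (o, a)` of an
operation symbol `o` and a tuple `a` of arguments, and a vertex for each place `i` of `t` (an
argument or the value), joined to `t`, to the element in place `i`, and to a colour, which is a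
vertex naming the pair `(o, i)`. Homomorphisms between such graphs come from homomorphisms of
algebras (`CodeV.exists_hom_of_hom`), provided that they fix the colours and do not mix the kinds of
vertices.

* Colours are fixed because they carry a rigid structure. They are well-ordered with a top element,
  and a sequence of auxiliary vertices marks, for each supremum `b` of a strictly increasing
  sequence of colours, one such sequence, the ladder of `b`. A strictly increasing map `f` that
  respects ladders is continuous at these `b`. If `f a > a`, then the supremum `b` of the iterates
  `f^[n] a` is fixed, hence so are the elements of its ladder; but `f` has no fixed points in `[a, b)`
  (`StrictMono.eq_self_of_ladder`).
* Finitely many kinds of vertices are kept apart by adding a finite transitive tournament with an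
  edge from its last to its first vertex. These two form the only two-way edge, so the tournament is
  fixed pointwise, and each kind of vertex can be recognized by its edges from and to the tournament
  (`pinned_hom_inl`, `pinned_hom_inr`).

If `A` and the set of operation symbols are finite, there are no ladders and the graph is finite;
otherwise the graph is no larger than the larger of the two sets.
-/

/-! ### The functor `G ↦ G ⋆ ℋ` -/

namespace SimpleGadget

variable {G G' : Gra.{u}}

/-- The height of a vertex of `G ⋆ ℋ`; it increases along every edge. -/
def starHeight (G : Gra.{u}) : (star G gadgetH).V → ℕ :=
  Sum.elim (fun _ => 1) (fun p => HVertex.height p.2.1)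

/-- The vertex `(u, v, 0)` of `G ⋆ ℋ`. -/
def zeroV (e : Edge G) : (star G gadgetH).V :=
  Sum.inr (e, ⟨HVertex.zero, by simp [gadgetH]⟩)

/-- The vertex `(u, v, 1)` of `G ⋆ ℋ`. -/
def oneV (e : Edge G) : (star G gadgetH).V :=
  Sum.inr (e, ⟨HVertex.one, by simp [gadgetH]⟩)

/-- The vertex `(u, v, 2)` of `G ⋆ ℋ`. -/
def twoV (e : Edge G) : (star G gadgetH).V :=
  Sum.inr (e, ⟨HVertex.two, by simp [gadgetH]⟩)

/-- A vertex of `G`, as a vertex of `G ⋆ ℋ`. -/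
def baseV (u : G.V) : (star G gadgetH).V := Sum.inl u

theorem starV_cases (a : (star G gadgetH).V) :
    (∃ u, a = baseV u) ∨ (∃ e, a = zeroV e) ∨ (∃ e, a = oneV e) ∨ ∃ e, a = twoV e := by
  obtain u | ⟨e, ⟨x, hs, ht⟩⟩ := a
  · exact Or.inl ⟨u, rfl⟩
  · cases x
    · exact absurd rfl hs
    · exact absurd rfl ht
    · exact Or.inr (Or.inl ⟨e, rfl⟩)
    · exact Or.inr (Or.inr (Or.inl ⟨e, rfl⟩))
    · exact Or.inr (Or.inr (Or.inr ⟨e, rfl⟩))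

@[simp] theorem starHeight_baseV (u : G.V) : starHeight G (baseV u) = 1 := rfl
@[simp] theorem starHeight_zeroV (e : Edge G) : starHeight G (zeroV e) = 2 := rfl
@[simp] theorem starHeight_oneV (e : Edge G) : starHeight G (oneV e) = 3 := rfl
@[simp] theorem starHeight_twoV (e : Edge G) : starHeight G (twoV e) = 0 := rfl

theorem baseV_injective : Function.Injective (baseV (G := G)) := fun _ _ h => Sum.inl.inj h

theorem zeroV_injective : Function.Injective (zeroV (G := G)) := fun _ _ h =>
  congrArg Prod.fst (Sum.inr.inj h)

theorem oneV_injective : Function.Injective (oneV (G := G)) := fun _ _ h =>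
  congrArg Prod.fst (Sum.inr.inj h)

theorem twoV_injective : Function.Injective (twoV (G := G)) := fun _ _ h =>
  congrArg Prod.fst (Sum.inr.inj h)

theorem starHeight_le (a : (star G gadgetH).V) : starHeight G a ≤ 3 := by
  obtain ⟨_, rfl⟩ | ⟨_, rfl⟩ | ⟨_, rfl⟩ | ⟨_, rfl⟩ := starV_cases a <;> simp

theorem phi_s (e : Edge G) : phi G gadgetH e HVertex.s = baseV e.1.1 := by
  simp [phi, gadgetH, baseV]

theorem phi_t (e : Edge G) : phi G gadgetH e HVertex.t = baseV e.1.2 := by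
  simp [phi, gadgetH, baseV]

theorem phi_zero (e : Edge G) : phi G gadgetH e HVertex.zero = zeroV e := by
  simp [phi, gadgetH, zeroV]

theorem phi_one (e : Edge G) : phi G gadgetH e HVertex.one = oneV e := by
  simp [phi, gadgetH, oneV]

theorem phi_two (e : Edge G) : phi G gadgetH e HVertex.two = twoV e := by
  simp [phi, gadgetH, twoV]

/-- The six kinds of edges of `G ⋆ ℋ`. -/
theorem star_adj_iff {a b : (star G gadgetH).V} : (star G gadgetH).Adj a b ↔
    ∃ e : Edge G, (a = twoV e ∧ b = baseV e.1.1) ∨ (a = twoV e ∧ b = oneV e) ∨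
      (a = twoV e ∧ b = baseV e.1.2) ∨ (a = baseV e.1.1 ∧ b = zeroV e) ∨
      (a = zeroV e ∧ b = oneV e) ∨ (a = baseV e.1.2 ∧ b = oneV e) := by
  constructor
  · rintro ⟨e, x, y, hxy, rfl, rfl⟩
    refine ⟨e, ?_⟩
    cases hxy
    · exact Or.inl ⟨phi_two e, phi_s e⟩
    · exact Or.inr (Or.inl ⟨phi_two e, phi_one e⟩)
    · exact Or.inr (Or.inr (Or.inl ⟨phi_two e, phi_t e⟩))
    · exact Or.inr (Or.inr (Or.inr (Or.inl ⟨phi_s e, phi_zero e⟩)))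
    · exact Or.inr (Or.inr (Or.inr (Or.inr (Or.inl ⟨phi_zero e, phi_one e⟩))))
    · exact Or.inr (Or.inr (Or.inr (Or.inr (Or.inr ⟨phi_t e, phi_one e⟩))))
  · rintro ⟨e, ⟨rfl, rfl⟩ | ⟨rfl, rfl⟩ | ⟨rfl, rfl⟩ | ⟨rfl, rfl⟩ | ⟨rfl, rfl⟩ | ⟨rfl, rfl⟩⟩
    · exact ⟨e, _, _, HAdj.two_s, phi_two e, phi_s e⟩
    · exact ⟨e, _, _, HAdj.two_one, phi_two e, phi_one e⟩
    · exact ⟨e, _, _, HAdj.two_t, phi_two e, phi_t e⟩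
    · exact ⟨e, _, _, HAdj.s_zero, phi_s e, phi_zero e⟩
    · exact ⟨e, _, _, HAdj.zero_one, phi_zero e, phi_one e⟩
    · exact ⟨e, _, _, HAdj.t_one, phi_t e, phi_one e⟩

theorem starHeight_lt {a b : (star G gadgetH).V} (h : (star G gadgetH).Adj a b) :
    starHeight G a < starHeight G b := by
  obtain ⟨e, ⟨rfl, rfl⟩ | ⟨rfl, rfl⟩ | ⟨rfl, rfl⟩ | ⟨rfl, rfl⟩ | ⟨rfl, rfl⟩ | ⟨rfl, rfl⟩⟩ :=
    star_adj_iff.1 h <;> simp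

theorem exists_baseV_of_height {a : (star G gadgetH).V} (h : starHeight G a = 1) :
    ∃ u, a = baseV u := by
  obtain h' | ⟨_, rfl⟩ | ⟨_, rfl⟩ | ⟨_, rfl⟩ := starV_cases a
  · exact h'
  all_goals simp at h

theorem exists_zeroV_of_height {a : (star G gadgetH).V} (h : starHeight G a = 2) :
    ∃ e, a = zeroV e := by
  obtain ⟨_, rfl⟩ | h' | ⟨_, rfl⟩ | ⟨_, rfl⟩ := starV_cases a
  · simp at h
  · exact h'
  all_goals simp at h

theorem exists_oneV_of_height {a : (star G gadgetH).V} (h : starHeight G a = 3) :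
    ∃ e, a = oneV e := by
  obtain ⟨_, rfl⟩ | ⟨_, rfl⟩ | h' | ⟨_, rfl⟩ := starV_cases a
  · simp at h
  · simp at h
  · exact h'
  · simp at h

theorem exists_twoV_of_height {a : (star G gadgetH).V} (h : starHeight G a = 0) :
    ∃ e, a = twoV e := by
  obtain ⟨_, rfl⟩ | ⟨_, rfl⟩ | ⟨_, rfl⟩ | h' := starV_cases a
  · simp at h
  · simp at h
  · simp at h
  · exact h'

theorem eq_of_baseV_adj_zeroV {u : G.V} {e : Edge G}
    (h : (star G gadgetH).Adj (baseV u) (zeroV e)) : u = e.1.1 := by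
  obtain ⟨e', h | h | h | h | h | h⟩ := star_adj_iff.1 h
  all_goals try have h1 := congrArg (starHeight G) h.1
  all_goals try have h2 := congrArg (starHeight G) h.2
  all_goals simp at h1 h2
  obtain rfl := zeroV_injective h.2
  exact baseV_injective h.1

theorem eq_of_zeroV_adj_oneV {e e' : Edge G}
    (h : (star G gadgetH).Adj (zeroV e) (oneV e')) : e = e' := by
  obtain ⟨e', h | h | h | h | h | h⟩ := star_adj_iff.1 h
  all_goals have h1 := congrArg (starHeight G) h.1
  all_goals have h2 := congrArg (starHeight G) h.2
  all_goals simp at h1 h2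
  exact (zeroV_injective h.1).trans (oneV_injective h.2).symm

theorem eq_of_twoV_adj_oneV {e e' : Edge G}
    (h : (star G gadgetH).Adj (twoV e) (oneV e')) : e = e' := by
  obtain ⟨e', h | h | h | h | h | h⟩ := star_adj_iff.1 h
  all_goals have h1 := congrArg (starHeight G) h.1
  all_goals have h2 := congrArg (starHeight G) h.2
  all_goals simp at h1 h2
  exact (twoV_injective h.1).trans (oneV_injective h.2).symm

theorem eq_of_baseV_adj_oneV {u : G.V} {e : Edge G}
    (h : (star G gadgetH).Adj (baseV u) (oneV e)) : u = e.1.2 := by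
  obtain ⟨e', h | h | h | h | h | h⟩ := star_adj_iff.1 h
  all_goals have h1 := congrArg (starHeight G) h.1
  all_goals have h2 := congrArg (starHeight G) h.2
  all_goals simp at h1 h2
  obtain rfl := oneV_injective h.2
  exact baseV_injective h.1

/-- A vertex strictly between `(u, v, 2)` and a vertex of the form `(u', v', 1)` is a vertex of
`G`: the only other out-neighbour of `(u, v, 2)` is `(u, v, 1)`, which is a sink. -/
theorem exists_baseV_of_between {a : (star G gadgetH).V} {e e' : Edge G}
    (h : (star G gadgetH).Adj (twoV e) a) (h' : (star G gadgetH).Adj a (oneV e')) :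
    ∃ u, a = baseV u := by
  obtain ⟨e'', h | h | h | h | h | h⟩ := star_adj_iff.1 h
  · exact ⟨_, h.2⟩
  · have := starHeight_lt h'
    simp [h.2] at this
  · exact ⟨_, h.2⟩
  all_goals
    have h1 := congrArg (starHeight G) h.1
    simp at h1

/-- A homomorphism between graphs of the form `G ⋆ ℋ` maps each copy of `ℋ` onto a copy of `ℋ`,
label by label. The path `2 → s → 0 → 1` has the maximal length `3`, so heights are preserved
along it; the edges `2 → 1` and `t → 1` then force the images to lie in a single copy. -/
theorem hom_star_edge (F : (star G gadgetH).Adj →r (star G' gadgetH).Adj) (e : Edge G) :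
    ∃ e' : Edge G', F (twoV e) = twoV e' ∧ F (zeroV e) = zeroV e' ∧ F (oneV e) = oneV e' ∧
      F (baseV e.1.1) = baseV e'.1.1 ∧ F (baseV e.1.2) = baseV e'.1.2 := by
  have a1 := F.map_rel (star_adj_iff.2 ⟨e, Or.inl ⟨rfl, rfl⟩⟩)
  have a2 := F.map_rel (star_adj_iff.2 ⟨e, Or.inr (Or.inl ⟨rfl, rfl⟩)⟩)
  have a3 := F.map_rel (star_adj_iff.2 ⟨e, Or.inr (Or.inr (Or.inl ⟨rfl, rfl⟩))⟩)
  have a4 := F.map_rel (star_adj_iff.2 ⟨e, Or.inr (Or.inr (Or.inr (Or.inl ⟨rfl, rfl⟩)))⟩)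
  have a5 := F.map_rel
    (star_adj_iff.2 ⟨e, Or.inr (Or.inr (Or.inr (Or.inr (Or.inl ⟨rfl, rfl⟩))))⟩)
  have a6 := F.map_rel
    (star_adj_iff.2 ⟨e, Or.inr (Or.inr (Or.inr (Or.inr (Or.inr ⟨rfl, rfl⟩))))⟩)
  have l1 := starHeight_lt a1
  have l4 := starHeight_lt a4
  have l5 := starHeight_lt a5
  have l := starHeight_le (F (oneV e))
  obtain ⟨e₂, h₂⟩ := exists_twoV_of_height (a := F (twoV e)) (by omega)
  obtain ⟨u, hu⟩ := exists_baseV_of_height (a := F (baseV e.1.1)) (by omega)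
  obtain ⟨e₀, h₀⟩ := exists_zeroV_of_height (a := F (zeroV e)) (by omega)
  obtain ⟨e₁, h₁⟩ := exists_oneV_of_height (a := F (oneV e)) (by omega)
  rw [h₀, h₁] at a5
  obtain rfl := eq_of_zeroV_adj_oneV a5
  rw [h₂, h₁] at a2
  obtain rfl := eq_of_twoV_adj_oneV a2
  rw [hu, h₀] at a4
  rw [h₂] at a3
  rw [h₁] at a6
  obtain ⟨v, hv⟩ := exists_baseV_of_between a3 a6
  rw [hv] at a6
  exact ⟨e₂, h₂, h₀, h₁, hu.trans (congrArg _ (eq_of_baseV_adj_zeroV a4)),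
    hv.trans (congrArg _ (eq_of_baseV_adj_oneV a6))⟩

end SimpleGadget

open SimpleGadget in
/-- In a connected graph with at least one edge, no vertex is isolated: if there is only one vertex,
the edge is a loop at it. -/
theorem Gra.connected.exists_edge {G : Gra.{u}} (h : Gra.connected G) (u : G.V) :
    ∃ e : Edge G, u = e.1.1 ∨ u = e.1.2 := by
  obtain ⟨hc, x, y, hxy⟩ := h
  rcases subsingleton_or_nontrivial G.V with hs | hn
  · exact ⟨⟨(x, y), hxy⟩, Or.inl (Subsingleton.elim _ _)⟩
  · obtain ⟨v, hv⟩ := hc.preconnected.exists_adj_of_nontrivial u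
    obtain ⟨-, h | h⟩ := hv
    · exact ⟨⟨(u, v), h⟩, Or.inl rfl⟩
    · exact ⟨⟨(v, u), h⟩, Or.inr rfl⟩

open SimpleGadget in
theorem starH_faithful : (starH.{u}).Faithful where
  map_injective {G G'} f g hfg := by
    apply ObjectProperty.hom_ext
    apply RelHom.ext
    intro u
    have h := congrArg (fun k => k.hom) hfg
    exact baseV_injective (DFunLike.congr_fun (F := RelHom _ _) h (baseV u))

open SimpleGadget in
theorem starH_full : (starH.{u}).Full where
  map_surjective {G G'} F := by
    let F' : (star G.obj gadgetH).Adj →r (star G'.obj gadgetH).Adj := F.hom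
    have hb : ∀ u : G.obj.V, ∃ u' : G'.obj.V, F' (baseV u) = baseV u' := by
      intro u
      obtain ⟨e, rfl | rfl⟩ := G.property.exists_edge u
      · obtain ⟨e', -, -, -, h, -⟩ := hom_star_edge F' e
        exact ⟨_, h⟩
      · obtain ⟨e', -, -, -, -, h⟩ := hom_star_edge F' e
        exact ⟨_, h⟩
    choose f hf using hb
    have key : ∀ e : Edge G.obj, ∃ e' : Edge G'.obj, e'.1 = (f e.1.1, f e.1.2) ∧
        F' (twoV e) = twoV e' ∧ F' (zeroV e) = zeroV e' ∧ F' (oneV e) = oneV e' := by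
      intro e
      obtain ⟨e', h2, h0, h1, hs, ht⟩ := hom_star_edge F' e
      rw [hf] at hs ht
      exact ⟨e', Prod.ext (baseV_injective hs).symm (baseV_injective ht).symm, h2, h0, h1⟩
    let f' : G.obj.Adj →r G'.obj.Adj := ⟨f, fun {u v} huv => by
      obtain ⟨e', he', -⟩ := key ⟨(u, v), huv⟩
      have := e'.2
      rwa [he'] at this⟩
    let f'' : G.obj ⟶ G'.obj := f'
    refine ⟨ObjectProperty.homMk f'', ?_⟩
    apply ObjectProperty.hom_ext
    refine RelHom.ext (f := starMap f'' gadgetH) (g := F') fun a => ?_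
    have he : ∀ (e : Edge G.obj) (e' : Edge G'.obj), e'.1 = (f e.1.1, f e.1.2) →
        mapEdge f'' e = e' := fun e e' h => Subtype.ext h.symm
    obtain ⟨u, rfl⟩ | ⟨e, rfl⟩ | ⟨e, rfl⟩ | ⟨e, rfl⟩ := starV_cases a
    · exact (hf u).symm
    · obtain ⟨e', h, h2, h0, h1⟩ := key e
      rw [h0, ← he e e' h]; rfl
    · obtain ⟨e', h, h2, h0, h1⟩ := key e
      rw [h1, ← he e e' h]; rfl
    · obtain ⟨e', h, h2, h0, h1⟩ := key e
      rw [h2, ← he e e' h]; rfl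

open SimpleGadget in
theorem starH_sizeLT (κ : Cardinal.{u}) (hκ : Cardinal.aleph0 ≤ κ) (G : ConGra.{u})
    (hG : sizeLT ConGra.{u} κ G) : sizeLT WGra.{u} κ (starH.obj G) := by
  have hG' : Cardinal.mk G.obj.V < κ := hG
  change Cardinal.mk (G.obj.V ⊕ (Edge G.obj × gadgetH.Inner)) < κ
  have : Finite gadgetH.V := inferInstanceAs (Finite HVertex)
  have hV : Cardinal.mk (G.obj.V × G.obj.V) < κ := by
    rw [← Cardinal.mul_def]
    exact Cardinal.mul_lt_of_lt hκ hG' hG'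
  have hE : Cardinal.mk (Edge G.obj) < κ :=
    (Cardinal.mk_le_of_injective Subtype.val_injective).trans_lt hV
  have hI : Cardinal.lift.{u} (Cardinal.mk gadgetH.Inner) < κ := by
    refine lt_of_lt_of_le ?_ hκ
    rw [Cardinal.lift_lt_aleph0]
    exact Cardinal.mk_lt_aleph0
  rw [Cardinal.mk_sum, Cardinal.mk_prod]
  simp only [Cardinal.lift_id, Cardinal.lift_uzero]
  exact Cardinal.add_lt_of_lt hκ hG' (Cardinal.mul_lt_of_lt hκ hE hI)

/-! ### Pinning down finitely many sorts of vertices -/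

/-- Given a relation `R` on `V` and a partition of `V` into `m` sorts, add to `V` the `m + 3` pins
`0, …, m + 2`. The pins form a transitive tournament together with the single edge `m + 2 → 0`, and
each `v` of sort `s` is put on a path `2 + s → v → 1`. -/
def PinnedAdj {V : Type u} {m : ℕ} (R : V → V → Prop) (sort : V → Fin m) :
    Fin (m + 3) ⊕ V → Fin (m + 3) ⊕ V → Prop
  | .inl i, .inl j => i < j ∨ (i.1 = m + 2 ∧ j.1 = 0)
  | .inl i, .inr v => i.1 = 2 + (sort v).1
  | .inr _, .inl j => j.1 = 1
  | .inr v, .inr w => R v w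

/-- The graph with edge relation `PinnedAdj`. -/
def pinned {V : Type u} {m : ℕ} (R : V → V → Prop) (sort : V → Fin m) : Gra.{u} where
  V := Fin (m + 3) ⊕ V
  graph := { Adj := PinnedAdj R sort }

section Pinned

variable {V V' : Type u} {m : ℕ} {R : V → V → Prop} {sort : V → Fin m}
  {R' : V' → V' → Prop} {sort' : V' → Fin m}

theorem pinned_connected : Gra.connected (pinned R sort) := by
  have key : ∀ x : Fin (m + 3) ⊕ V,
      (pinned R sort).graph.toSimpleGraphInclusive.Reachable (Sum.inl 1) x := by
    have adj : ∀ x y : Fin (m + 3) ⊕ V, x ≠ y → PinnedAdj R sort x y ∨ PinnedAdj R sort y x →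
        (pinned R sort).graph.toSimpleGraphInclusive.Reachable x y := fun x y hne h =>
      SimpleGraph.Adj.reachable ⟨hne, h⟩
    rintro (i | v)
    · rcases lt_trichotomy (1 : Fin (m + 3)) i with h | rfl | h
      · exact adj _ _ (by simpa using h.ne) (Or.inl (Or.inl h))
      · exact SimpleGraph.Reachable.refl _
      · exact adj _ _ (by simpa using h.ne') (Or.inr (Or.inl h))
    · exact adj _ _ (by simp) (Or.inr (by simp [PinnedAdj]))
  have : Nonempty (pinned R sort).V := ⟨Sum.inl 1⟩
  refine ⟨SimpleGraph.Connected.mk fun x y => (key x).symm.trans (key y), Sum.inl 0, Sum.inl 1, ?_⟩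
  exact Or.inl (by simp)

/-- The only pair of vertices joined by edges in both directions is `{0, m + 2}`. -/
theorem PinnedAdj.eq_of_symm (hR : ∀ v w, R v w → ¬ R w v) {a b : Fin (m + 3) ⊕ V}
    (hab : PinnedAdj R sort a b) (hba : PinnedAdj R sort b a) :
    (a = Sum.inl 0 ∧ b = Sum.inl (Fin.last _)) ∨ (a = Sum.inl (Fin.last _) ∧ b = Sum.inl 0) := by
  obtain i | v := a <;> obtain j | w := b
  · simp only [PinnedAdj, Fin.lt_def] at hab hba
    simp only [Sum.inl.injEq, Fin.ext_iff, Fin.val_last, Fin.val_zero]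
    omega
  · simp only [PinnedAdj] at hab hba
    omega
  · simp only [PinnedAdj] at hab hba
    omega
  · exact absurd hba (hR _ _ hab)

/-- A homomorphism of pinned graphs fixes all pins. The pair `{0, m + 2}` is the only two-way edge,
and it cannot be swapped since no path of length two leads from `m + 2` to `0`. The remaining pins
are the only vertices between `0` and `m + 2`, and are linearly ordered. -/
theorem pinned_hom_inl (hR' : ∀ v w, R' v w → ¬ R' w v)
    (F : PinnedAdj R sort →r PinnedAdj R' sort') (i : Fin (m + 3)) :
    F (Sum.inl i) = Sum.inl i := by
  have hlt : ∀ i j : Fin (m + 3), i < j → PinnedAdj R' sort' (F (Sum.inl i)) (F (Sum.inl j)) :=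
    fun i j h => F.map_rel (Or.inl h)
  have h0 : (0 : Fin (m + 3)) < Fin.last _ := by simp [Fin.lt_def]
  have h01 : (0 : Fin (m + 3)) < 1 := by simp
  have h1l : (1 : Fin (m + 3)) < Fin.last _ := by simp [Fin.lt_def]
  have ends : F (Sum.inl 0) = Sum.inl 0 ∧ F (Sum.inl (Fin.last _)) = Sum.inl (Fin.last _) := by
    rcases PinnedAdj.eq_of_symm hR' (hlt _ _ h0) (F.map_rel (Or.inr ⟨rfl, rfl⟩)) with h | ⟨ha, hb⟩
    · exact h
    · exfalso
      have h1 := hlt _ _ h01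
      have h2 := hlt _ _ h1l
      rw [ha] at h1
      rw [hb] at h2
      generalize F (Sum.inl 1) = x at h1 h2
      obtain j | v := x
      · simp only [PinnedAdj, Fin.lt_def, Fin.val_last, Fin.val_zero] at h1 h2
        omega
      · simp only [PinnedAdj, Fin.val_zero] at h2
        omega
  have mem : ∀ i : Fin (m + 3), ∃ j : Fin (m + 3), F (Sum.inl i) = Sum.inl j ∧
      (0 < i → i < Fin.last _ → 0 < j ∧ j < Fin.last _) := by
    intro i
    rcases eq_or_lt_of_le (Fin.zero_le i) with rfl | hi0
    · exact ⟨0, ends.1, fun h => absurd h (lt_irrefl _)⟩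
    rcases eq_or_lt_of_le (Fin.le_last i) with rfl | hil
    · exact ⟨Fin.last _, ends.2, fun _ h => absurd h (lt_irrefl _)⟩
    have h1 := hlt _ _ hi0
    have h2 := hlt _ _ hil
    rw [ends.1] at h1
    rw [ends.2] at h2
    generalize F (Sum.inl i) = x at h1 h2 ⊢
    obtain j | v := x
    · refine ⟨j, rfl, fun _ _ => ?_⟩
      simp only [PinnedAdj, Fin.lt_def, Fin.val_last, Fin.val_zero] at h1 h2 ⊢
      omega
    · simp only [PinnedAdj, Fin.val_last] at h2
      omega
  choose g hg hg' using mem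
  have g0 : g 0 = 0 := Sum.inl.inj ((hg 0).symm.trans ends.1)
  have gl : g (Fin.last _) = Fin.last _ := Sum.inl.inj ((hg _).symm.trans ends.2)
  have mono : StrictMono g := by
    intro i j hij
    have h := hlt _ _ hij
    rw [hg, hg] at h
    rcases h with h | ⟨hi, hj⟩
    · exact h
    · -- the back edge `m + 2 → 0` would need `g i = m + 2`, hence `i = m + 2`, but `i < j`
      exfalso
      rcases eq_or_lt_of_le (Fin.zero_le i) with rfl | hi0
      · rw [g0] at hi
        simp at hi
      · have := (hg' i hi0 (hij.trans_le (Fin.le_last _))).2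
        simp only [Fin.lt_def, Fin.val_last] at this
        omega
  rw [hg, mono.eq_id]
  rfl

/-- A homomorphism of pinned graphs maps vertices of sort `s` to vertices of sort `s`: these are
the only vertices on a path from the pin `2 + s` to the pin `1`. -/
theorem pinned_hom_inr (hR' : ∀ v w, R' v w → ¬ R' w v)
    (F : PinnedAdj R sort →r PinnedAdj R' sort') (v : V) :
    ∃ v', F (Sum.inr v) = Sum.inr v' ∧ sort' v' = sort v := by
  have h1 := F.map_rel (a := Sum.inl ⟨2 + (sort v).1, by omega⟩) (b := Sum.inr v) rfl
  have h2 := F.map_rel (a := Sum.inr v) (b := Sum.inl 1) (by simp [PinnedAdj])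
  rw [pinned_hom_inl hR'] at h1 h2
  generalize F (Sum.inr v) = x at h1 h2 ⊢
  obtain j | w := x
  · exfalso
    simp only [PinnedAdj, Fin.lt_def, Fin.val_one] at h1 h2
    omega
  · refine ⟨w, rfl, Fin.ext ?_⟩
    simp only [PinnedAdj] at h1
    omega

end Pinned

/-! ### A rigid structure on a well-ordered set -/

section Ladder

variable {X : Type u} [LinearOrder X]

/-- The supremum of a strictly increasing sequence. -/
def IsOmegaLimit (b : X) : Prop := ∃ l : ℕ → X, StrictMono l ∧ IsLUB (Set.range l) b

/-- A chosen strictly increasing sequence with supremum `b`. -/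
noncomputable def ladder (b : {b : X // IsOmegaLimit b}) : ℕ → X := b.2.choose

theorem ladder_strictMono (b : {b : X // IsOmegaLimit b}) : StrictMono (ladder b) :=
  b.2.choose_spec.1

theorem ladder_isLUB (b : {b : X // IsOmegaLimit b}) : IsLUB (Set.range (ladder b)) b.1 :=
  b.2.choose_spec.2

theorem ladder_lt (b : {b : X // IsOmegaLimit b}) (n : ℕ) : ladder b n < b.1 :=
  (ladder_strictMono b n.lt_succ_self).trans_le ((ladder_isLUB b).1 ⟨_, rfl⟩)

/-- A strictly increasing self-map of a well-order with a top element is the identity as soon as it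
commutes with the choice of ladders. If `f a > a`, let `b` be the supremum of the iterates `f^[n] a`.
Because `f` maps the ladder of `b` to the ladder of `f b`, it is continuous at `b`, so that
`f b = b`, and then `f` fixes every element of the ladder of `b`. But `f` has no fixed point in the
interval `[a, b)`. -/
theorem StrictMono.eq_self_of_ladder [WellFoundedLT X] [OrderTop X] {f : X → X} (hf : StrictMono f)
    (hl : ∀ b : {b : X // IsOmegaLimit b}, ∃ h : IsOmegaLimit (f b.1),
      ∀ n, f (ladder b n) = ladder ⟨f b.1, h⟩ n) (a : X) : f a = a := by
  by_contra hne
  have ha : a < f a := lt_of_le_of_ne hf.le_apply (Ne.symm hne)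
  let s : ℕ → X := fun n => f^[n] a
  have hs1 : ∀ n, s (n + 1) = f (s n) := fun n => Function.iterate_succ_apply' f n a
  have hs : StrictMono s := by
    refine strictMono_nat_of_lt_succ fun n => ?_
    induction n with
    | zero => exact ha
    | succ n ih => rw [hs1 n, hs1 (n + 1)]; exact hf ih
  obtain ⟨b, hb, hmin⟩ := WellFounded.has_min (wellFounded_lt (α := X))
    (upperBounds (Set.range s)) ⟨⊤, fun _ _ => le_top⟩
  have hlub : IsLUB (Set.range s) b := ⟨hb, fun c hc => not_lt.1 (hmin c hc)⟩
  have hsb : ∀ n, s n < b := fun n => (hs n.lt_succ_self).trans_le (hb ⟨_, rfl⟩)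
  have hblt : ∀ c, c < b → f c < b := by
    intro c hc
    obtain ⟨_, ⟨n, rfl⟩, hn, -⟩ := hlub.exists_between hc
    calc f c < f (s n) := hf hn
      _ = s (n + 1) := (hs1 n).symm
      _ < b := hsb _
  obtain ⟨h, hl⟩ := hl ⟨b, s, hs, hlub⟩
  have hfb : f b = b := by
    refine le_antisymm ((ladder_isLUB ⟨f b, h⟩).2 ?_) hf.le_apply
    rintro _ ⟨n, rfl⟩
    rw [← hl]
    exact (hblt _ (ladder_lt _ n)).le
  have hfix : ∀ n, f (ladder ⟨b, s, hs, hlub⟩ n) = ladder ⟨b, s, hs, hlub⟩ n := by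
    intro n
    rw [hl]
    congr 2
  have hla := (ladder_isLUB ⟨b, s, hs, hlub⟩)
  obtain ⟨_, ⟨k, rfl⟩, hk, -⟩ := hla.exists_between (hsb 0)
  -- the fixed point `c = ladder b k` lies above `s 0`, hence above every `s n`
  have hge : ∀ n, s n < ladder ⟨b, s, hs, hlub⟩ k := by
    intro n
    induction n with
    | zero => exact hk
    | succ n ih => rw [hs1, ← hfix k]; exact hf ih
  refine (ladder_lt ⟨b, s, hs, hlub⟩ k).not_ge (hlub.2 ?_)
  rintro _ ⟨n, rfl⟩
  exact (hge n).le

end Ladder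

/-! ### Coding an algebra as a graph with sorts -/

/-- The operation symbols of `Δ`, of all arities. -/
abbrev OpSymbol (Δ : FirstOrder.Language.{u, u}) : Type u := Σ n, Δ.Functions n

/-- The places of the operation symbols of `Δ`: the arguments of `o` are the `some i`, the value is
`none`. -/
def Place (Δ : FirstOrder.Language.{u, u}) : Type u := Σ o : OpSymbol Δ, Option (Fin o.1)

open Classical in
/-- An arbitrary well-ordering of the places. -/
noncomputable instance Place.linearOrder (Δ : FirstOrder.Language.{u, u}) : LinearOrder (Place Δ) :=
  linearOrderOfSTO WellOrderingRel

instance Place.wellFoundedLT (Δ : FirstOrder.Language.{u, u}) : WellFoundedLT (Place Δ) :=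
  ⟨(WellOrderingRel.isWellOrder (α := Place Δ)).wf⟩

/-- The colours: the places and an additional top element, which ensures that all sequences of
colours have a supremum. -/
abbrev Colour (Δ : FirstOrder.Language.{u, u}) : Type u := WithTop (Place Δ)

/-- The pairs `(o, a)` of an operation symbol `o` and a tuple `a` of arguments for it. -/
abbrev OpTuple (Δ : FirstOrder.Language.{u, u}) (A : Type u) : Type u :=
  Σ o : OpSymbol Δ, (Fin o.1 → A)

namespace OpTuple

variable {Δ : FirstOrder.Language.{u, u}} {A B : Type u}

/-- The element in place `i` of the equation `o(a₁, …, aₙ) = a₀`, where `(o, a) = t`. -/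
def entry [Δ.Structure A] (t : OpTuple Δ A) : Option (Fin t.1.1) → A
  | none => FirstOrder.Language.Structure.funMap t.1.2 t.2
  | some i => t.2 i

/-- Applying a map to all arguments. -/
def map (h : A → B) (t : OpTuple Δ A) : OpTuple Δ B := ⟨t.1, h ∘ t.2⟩

end OpTuple

/-- The vertices of the graph coding an algebra on `A`: the elements of `A`, the colours, a ladder
of vertices `(b, 0), (b, 1), …` for each colour `b` that is the supremum of a strictly increasing
sequence, a vertex for each `t = (o, a)`, and a vertex for each place of each such `t`. -/
inductive CodeV (Δ : FirstOrder.Language.{u, u}) (A : Type u) : Type u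
  | pt (a : A)
  | col (c : Colour Δ)
  | rung (b : {b : Colour Δ // IsOmegaLimit b}) (n : ℕ)
  | tup (t : OpTuple Δ A)
  | slot (t : OpTuple Δ A) (i : Option (Fin t.1.1))

namespace CodeV

variable {Δ : FirstOrder.Language.{u, u}} {A B : Type u}

/-- The sorts of vertices; the bottom rungs of the ladders form a sort of their own. -/
def sort : CodeV Δ A → Fin 6
  | pt _ => 0
  | col _ => 1
  | rung _ 0 => 2
  | rung _ (_ + 1) => 3
  | tup _ => 4
  | slot _ _ => 5

/-- The edges: colours are joined by their order, the ladder of `b` is a path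
`(b, 0) → (b, 1) → …` with edges `b → (b, n) → ladder b n`, and the vertex for place `i` of `t` has
edges to `t`, to the element in this place, and to the colour naming the place. -/
def Adj [Δ.Structure A] : CodeV Δ A → CodeV Δ A → Prop
  | col c, col d => c < d
  | col c, rung b _ => c = b.1
  | rung b n, col c => c = ladder b n
  | rung b n, rung b' n' => b' = b ∧ n' = n + 1
  | slot t _, tup t' => t' = t
  | slot t i, pt a => a = t.entry i
  | slot t i, col c => c = WithTop.some (α := Place Δ) ⟨t.1, i⟩
  | _, _ => False

theorem Adj.asymm [Δ.Structure A] (v w : CodeV Δ A) (h : Adj v w) : ¬ Adj w v := by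
  intro h'
  cases v <;> cases w <;> simp only [Adj] at h h'
  · exact lt_asymm h h'
  · subst h
    exact (ladder_lt _ _).ne' h'
  · subst h'
    exact (ladder_lt _ _).ne' h
  · omega

/-- The map induced on vertices by a map of algebras. -/
def map (h : A → B) : CodeV Δ A → CodeV Δ B
  | pt a => pt (h a)
  | col c => col c
  | rung b n => rung b n
  | tup t => tup (t.map h)
  | slot t i => slot (t.map h) i

@[simp] theorem sort_map (h : A → B) (v : CodeV Δ A) : sort (map h v) = sort v := by
  obtain _ | _ | ⟨_, _ | _⟩ | _ | _ := v <;> rfl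

theorem exists_pt {v : CodeV Δ A} (h : sort v = 0) : ∃ a, v = pt a := by
  obtain a | _ | ⟨_, _ | _⟩ | _ | _ := v
  · exact ⟨a, rfl⟩
  all_goals exact absurd h (by simp [sort])

theorem exists_col {v : CodeV Δ A} (h : sort v = 1) : ∃ c, v = col c := by
  obtain _ | c | ⟨_, _ | _⟩ | _ | _ := v
  rotate_left
  · exact ⟨c, rfl⟩
  all_goals exact absurd h (by simp [sort])

theorem exists_rung_zero {v : CodeV Δ A} (h : sort v = 2) : ∃ b, v = rung b 0 := by
  obtain _ | _ | ⟨b, _ | _⟩ | _ | _ := v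
  rotate_left 2
  · exact ⟨b, rfl⟩
  all_goals exact absurd h (by simp [sort])

theorem exists_rung_succ {v : CodeV Δ A} (h : sort v = 3) : ∃ b n, v = rung b n := by
  obtain _ | _ | ⟨b, _ | n⟩ | _ | _ := v
  rotate_left 3
  · exact ⟨b, _, rfl⟩
  all_goals exact absurd h (by simp [sort])

theorem exists_tup {v : CodeV Δ A} (h : sort v = 4) : ∃ t, v = tup t := by
  obtain _ | _ | ⟨_, _ | _⟩ | t | _ := v
  rotate_left 4
  · exact ⟨t, rfl⟩
  all_goals exact absurd h (by simp [sort])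

theorem exists_slot {v : CodeV Δ A} (h : sort v = 5) : ∃ t i, v = slot t i := by
  obtain _ | _ | ⟨_, _ | _⟩ | _ | ⟨t, i⟩ := v
  rotate_left 5
  · exact ⟨t, i, rfl⟩
  all_goals exact absurd h (by simp [sort])

variable [Δ.Structure A] [Δ.Structure B]

theorem entry_map (h : Δ.Hom A B) (t : OpTuple Δ A) (i : Option (Fin t.1.1)) :
    (t.map h).entry i = h (t.entry i) := by
  cases i
  · exact (h.map_fun t.1.2 t.2).symm
  · rfl

theorem Adj.map (h : Δ.Hom A B) {v w : CodeV Δ A} (hvw : Adj v w) :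
    Adj (CodeV.map h v) (CodeV.map h w) := by
  cases v <;> cases w <;> simp only [Adj, CodeV.map] at hvw ⊢
  any_goals exact hvw
  · rw [hvw, entry_map]
  · rw [hvw]

/-- A map preserving sorts and edges fixes all colours: it induces a strictly increasing map of the
colours that commutes with the choice of ladders. Each ladder has to be followed from its bottom
rung, which is recognized by its sort. -/
theorem hom_fixes_colours {g : CodeV Δ A → CodeV Δ B} (hs : ∀ v, sort (g v) = sort v)
    (hg : ∀ v w, Adj v w → Adj (g v) (g w)) :
    (∀ c, g (col c) = col c) ∧ ∀ b n, g (rung b n) = rung b n := by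
  choose k hk using fun c => exists_col ((hs (col c)).trans rfl)
  have hmono : StrictMono k := by
    intro c d hcd
    have := hg (col c) (col d) hcd
    rwa [hk, hk] at this
  have hrung : ∀ b, ∃ h : IsOmegaLimit (k b.1), ∀ n, g (rung b n) = rung ⟨k b.1, h⟩ n := by
    intro b
    obtain ⟨b', hb'⟩ := exists_rung_zero ((hs (rung b 0)).trans rfl)
    have h0 := hg (col b.1) (rung b 0) rfl
    rw [hk, hb'] at h0
    have h0' : k b.1 = b'.1 := h0
    refine ⟨h0' ▸ b'.2, fun n => ?_⟩
    have hbb : (⟨k b.1, h0' ▸ b'.2⟩ : {b : Colour Δ // IsOmegaLimit b}) = b' := Subtype.ext h0'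
    rw [hbb]
    induction n with
    | zero => exact hb'
    | succ n ih =>
      obtain ⟨b'', m, hm⟩ := exists_rung_succ ((hs (rung b (n + 1))).trans rfl)
      have h1 := hg (rung b n) (rung b (n + 1)) ⟨rfl, rfl⟩
      rw [ih, hm] at h1
      obtain ⟨rfl, rfl⟩ := h1
      exact hm
  have hid : ∀ c, k c = c := by
    refine hmono.eq_self_of_ladder fun b => ?_
    obtain ⟨h, hn⟩ := hrung b
    refine ⟨h, fun n => ?_⟩
    have h1 := hg (rung b n) (col (ladder b n)) rfl
    rw [hn, hk] at h1
    exact h1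
  refine ⟨fun c => (hk c).trans (congrArg _ (hid c)), fun b n => ?_⟩
  obtain ⟨h, hn⟩ := hrung b
  rw [hn]
  congr 1
  exact Subtype.ext (hid b.1)

/-- The maps preserving sorts and edges are those induced by homomorphisms of algebras. Since the
colours are fixed, the vertices for the places of `(o, a)` go to the vertices for the same places of
some `(o, a')`, and the edges to the elements of the algebra give `a' = h ∘ a` and
`h (o(a)) = o(a')`. -/
theorem exists_hom_of_hom [Δ.IsAlgebraic] {g : CodeV Δ A → CodeV Δ B}
    (hs : ∀ v, sort (g v) = sort v) (hg : ∀ v w, Adj v w → Adj (g v) (g w)) :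
    ∃ h : Δ.Hom A B, g = map h := by
  obtain ⟨hcol, hrung⟩ := hom_fixes_colours hs hg
  choose h hh using fun a => exists_pt ((hs (pt a)).trans rfl)
  have key : ∀ t : OpTuple Δ A, g (tup t) = tup (t.map h) ∧
      ∀ i, g (slot t i) = slot (t.map h) i ∧ h (t.entry i) = (t.map h).entry i := by
    intro t
    obtain ⟨t', ht'⟩ := exists_tup ((hs (tup t)).trans rfl)
    have hslot : ∀ i : Option (Fin t.1.1), ∃ a : Fin t.1.1 → B, t' = ⟨t.1, a⟩ ∧
        g (slot t i) = slot ⟨t.1, a⟩ i ∧ h (t.entry i) = OpTuple.entry ⟨t.1, a⟩ i := by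
      intro i
      obtain ⟨s, j, hsj⟩ := exists_slot ((hs (slot t i)).trans rfl)
      have h1 := hg (slot t i) (tup t) rfl
      have h2 := hg (slot t i) (pt (t.entry i)) rfl
      have h3 := hg (slot t i) (col (WithTop.some (α := Place Δ) ⟨t.1, i⟩)) rfl
      rw [hsj, ht'] at h1
      rw [hsj, hh] at h2
      rw [hsj, hcol] at h3
      have h1' : t' = s := h1
      have h2' : h (t.entry i) = s.entry j := h2
      have h3' : (⟨t.1, i⟩ : Place Δ) = ⟨s.1, j⟩ := WithTop.coe_injective h3
      obtain ⟨o, a⟩ := s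
      dsimp only at j hsj h1' h2' h3'
      obtain ⟨ho, hi⟩ := Sigma.mk.inj h3'
      subst ho
      obtain rfl := eq_of_heq hi
      exact ⟨a, h1', hsj, h2'⟩
    obtain ⟨a, rfl, -, -⟩ := hslot none
    have ha : (⟨t.1, a⟩ : OpTuple Δ B) = t.map h := by
      refine congrArg (Sigma.mk t.1) (funext fun i => ?_)
      obtain ⟨a', he, -, hi⟩ := hslot (some i)
      obtain rfl := eq_of_heq (Sigma.mk.inj he).2
      exact hi.symm
    refine ⟨ha ▸ ht', fun i => ?_⟩
    obtain ⟨a', he, hi, hi'⟩ := hslot i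
    obtain rfl := eq_of_heq (Sigma.mk.inj he).2
    have ha' : a = h ∘ t.2 := eq_of_heq (Sigma.mk.inj ha).2
    subst ha'
    exact ⟨hi, hi'⟩
  let h' : Δ.Hom A B :=
    { toFun := h
      map_fun' := fun {n} f x => ((key ⟨⟨n, f⟩, x⟩).2 none).2
      map_rel' := fun {n} r _ => isEmptyElim r }
  refine ⟨h', funext fun v => ?_⟩
  obtain a | c | ⟨b, n⟩ | t | ⟨t, i⟩ := v
  · exact hh a
  · exact hcol c
  · exact hrung b n
  · exact (key t).1
  · exact ((key t).2 i).1

end CodeV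

/-! ### The embedding of algebras into connected graphs -/

section Embedding

variable (Δ : FirstOrder.Language.{u, u})

/-- The functor assigning to an algebra its coding graph with pinned sorts. -/
noncomputable def algToConGra : UAlg Δ ⥤ ConGra.{u} where
  obj A := ⟨pinned (CodeV.Adj (Δ := Δ) (A := A.carrier)) CodeV.sort, pinned_connected⟩
  map {A B} h := ObjectProperty.homMk
    (ConcreteCategory.ofHom (C := Gra.{u})
      (X := pinned (CodeV.Adj (Δ := Δ) (A := A.carrier)) CodeV.sort)
      (Y := pinned (CodeV.Adj (Δ := Δ) (A := B.carrier)) CodeV.sort)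
      { toFun := Sum.map id (CodeV.map (ConcreteCategory.hom (C := UAlg Δ) h))
        map_rel' := by
          rintro (i | v) (j | w) hvw
          · exact hvw
          · exact (show i.1 = 2 + (CodeV.sort w).1 from hvw).trans (by simp)
          · exact hvw
          · exact CodeV.Adj.map (ConcreteCategory.hom (C := UAlg Δ) h) hvw })
  map_id A := by
    apply ObjectProperty.hom_ext
    apply RelHom.ext
    rintro (i | a | c | ⟨b, n⟩ | t | ⟨t, i⟩) <;> rfl
  map_comp f g := by
    apply ObjectProperty.hom_ext
    apply RelHom.ext
    rintro (i | a | c | ⟨b, n⟩ | t | ⟨t, i⟩) <;> rfl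

instance algToConGra_faithful : (algToConGra Δ).Faithful where
  map_injective {A B} f g hfg := by
    refine FirstOrder.Language.Hom.ext fun a => ?_
    have h := congrArg (fun k => k.hom) hfg
    have h' := DFunLike.congr_fun (F := RelHom _ _) h (Sum.inr (CodeV.pt a))
    exact CodeV.pt.inj (Sum.inr.inj h')

instance algToConGra_full [Δ.IsAlgebraic] : (algToConGra Δ).Full where
  map_surjective {A B} F := by
    let F' : PinnedAdj (CodeV.Adj (Δ := Δ) (A := A.carrier)) CodeV.sort →r
      PinnedAdj (CodeV.Adj (Δ := Δ) (A := B.carrier)) CodeV.sort := F.hom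
    choose g hg hs using pinned_hom_inr CodeV.Adj.asymm F'
    obtain ⟨h, rfl⟩ := CodeV.exists_hom_of_hom (A := A.carrier) (B := B.carrier) hs
      (fun v w hvw => by
        have := F'.map_rel (a := Sum.inr v) (b := Sum.inr w) hvw
        rwa [hg, hg] at this)
    refine ⟨h, ?_⟩
    apply ObjectProperty.hom_ext
    refine RelHom.ext fun x => ?_
    obtain i | v := x
    · exact (pinned_hom_inl CodeV.Adj.asymm F' i).symm
    · exact (hg v).symm

end Embedding

/-! ### Sizes -/

section Sizes

open Cardinal

/-- The vertices of the coding graph, by sort. -/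
def CodeV.equivSum (Δ : FirstOrder.Language.{u, u}) (A : Type u) :
    CodeV Δ A ≃ A ⊕ Colour Δ ⊕ ({b : Colour Δ // IsOmegaLimit b} × ℕ) ⊕ OpTuple Δ A ⊕
      (Σ t : OpTuple Δ A, Option (Fin t.1.1)) where
  toFun
    | pt a => .inl a
    | col c => .inr (.inl c)
    | rung b n => .inr (.inr (.inl (b, n)))
    | tup t => .inr (.inr (.inr (.inl t)))
    | slot t i => .inr (.inr (.inr (.inr ⟨t, i⟩)))
  invFun
    | .inl a => pt a
    | .inr (.inl c) => col c
    | .inr (.inr (.inl (b, n))) => rung b n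
    | .inr (.inr (.inr (.inl t))) => tup t
    | .inr (.inr (.inr (.inr ⟨t, i⟩))) => slot t i
  left_inv v := by cases v <;> rfl
  right_inv v := by obtain _ | _ | ⟨_, _⟩ | _ | ⟨_, _⟩ := v <;> rfl

theorem not_isOmegaLimit_of_finite {X : Type u} [LinearOrder X] [Finite X] (b : X) :
    ¬ IsOmegaLimit b := fun ⟨_, hl, _⟩ => not_injective_infinite_finite _ hl.injective

/-- Finite algebras with finitely many operations have finite coding graphs. In this case no colour
is a supremum of a strictly increasing sequence, so that there are no ladders. -/
theorem CodeV.finite (Δ : FirstOrder.Language.{u, u}) (A : Type u) [Finite (OpSymbol Δ)]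
    [Finite A] : Finite (CodeV Δ A) := by
  have : Finite (Place Δ) := inferInstanceAs (Finite (Σ o : OpSymbol Δ, Option (Fin o.1)))
  have : Finite (Colour Δ) := inferInstanceAs (Finite (Option (Place Δ)))
  have : IsEmpty {b : Colour Δ // IsOmegaLimit b} :=
    ⟨fun b => not_isOmegaLimit_of_finite b.1 b.2⟩
  exact Finite.of_equiv _ (CodeV.equivSum Δ A).symm

theorem mk_sigma_le_of_le {ι : Type u} {f : ι → Type u} {c : Cardinal.{u}} (hc : ℵ₀ ≤ c)
    (hι : #ι ≤ c) (hf : ∀ i, #(f i) ≤ c) : #(Σ i, f i) ≤ c := by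
  rw [mk_sigma]
  calc Cardinal.sum (fun i => #(f i)) ≤ Cardinal.sum (fun _ : ι => c) := Cardinal.sum_le_sum _ _ hf
    _ = #ι * c := by simp
    _ ≤ c * c := by gcongr
    _ = c := Cardinal.mul_eq_self hc

theorem CodeV.mk_le {Δ : FirstOrder.Language.{u, u}} {A : Type u} {c : Cardinal.{u}}
    (hc : ℵ₀ ≤ c) (hΔ : #(OpSymbol Δ) ≤ c) (hA : #A ≤ c) : #(CodeV Δ A) ≤ c := by
  have hfin : ∀ (ι : Type u) [Finite ι], #ι ≤ c := fun ι _ => Cardinal.mk_lt_aleph0.le.trans hc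
  have hopt : ∀ (ι : Type u) (n : ι → ℕ), #ι ≤ c → #(Σ i, Option (Fin (n i))) ≤ c := by
    intro ι n hι
    rw [Cardinal.mk_congr (Equiv.sigmaCongrRight fun i => (Equiv.ulift.{u}).symm)]
    exact mk_sigma_le_of_le hc hι fun i => hfin _
  have hplace : #(Place Δ) ≤ c := hopt (OpSymbol Δ) (fun o => o.1) hΔ
  have hcol : #(Colour Δ) ≤ c := by
    change #(Option (Place Δ)) ≤ c
    rw [Cardinal.mk_option]
    exact Cardinal.add_le_of_le hc hplace (Cardinal.one_le_aleph0.trans hc)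
  have hlim : #({b : Colour Δ // IsOmegaLimit b} × ℕ) ≤ c := by
    rw [Cardinal.mk_prod, Cardinal.lift_uzero, Cardinal.mk_nat, Cardinal.lift_aleph0]
    exact Cardinal.mul_le_of_le hc
      ((Cardinal.mk_le_of_injective Subtype.val_injective).trans hcol) hc
  have htup : #(OpTuple Δ A) ≤ c := by
    refine mk_sigma_le_of_le hc hΔ fun o => ?_
    rw [Cardinal.mk_arrow, Cardinal.lift_uzero, Cardinal.mk_fin, Cardinal.lift_natCast,
      Cardinal.power_natCast]
    exact (pow_le_pow_left' hA _).trans (Cardinal.power_nat_le hc)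
  have hslot : #(Σ t : OpTuple Δ A, Option (Fin t.1.1)) ≤ c := hopt _ (fun t => t.1.1) htup
  rw [Cardinal.mk_congr (CodeV.equivSum Δ A)]
  simp only [Cardinal.mk_sum, Cardinal.lift_id]
  exact Cardinal.add_le_of_le hc hA (Cardinal.add_le_of_le hc hcol (Cardinal.add_le_of_le hc hlim
    (Cardinal.add_le_of_le hc htup hslot)))

theorem algToConGra_sizeLT {Δ : FirstOrder.Language.{u, u}} {κ : Cardinal.{u}} (hκ : ℵ₀ ≤ κ)
    (hΔ : Δ.card < κ) {A : UAlg Δ} (hA : sizeLT (UAlg Δ) κ A) :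
    sizeLT ConGra.{u} κ ((algToConGra Δ).obj A) := by
  have hA' : #A.carrier < κ := hA
  have hO : #(OpSymbol Δ) < κ := (Cardinal.mk_le_of_injective Sum.inl_injective).trans_lt hΔ
  change #(Fin (6 + 3) ⊕ CodeV Δ A.carrier) < κ
  rw [Cardinal.mk_sum]
  refine Cardinal.add_lt_of_lt hκ
    ((Cardinal.lift_lt_aleph0.2 Cardinal.mk_lt_aleph0).trans_le hκ) ?_
  rw [Cardinal.lift_uzero]
  rcases lt_or_ge (max #(OpSymbol Δ) #A.carrier) ℵ₀ with h | h
  · have := Cardinal.lt_aleph0_iff_finite.1 ((le_max_left _ _).trans_lt h)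
    have := Cardinal.lt_aleph0_iff_finite.1 ((le_max_right _ _).trans_lt h)
    have := CodeV.finite Δ A.carrier
    exact Cardinal.mk_lt_aleph0.trans_le hκ
  · exact (CodeV.mk_le h (le_max_left _ _) (le_max_right _ _)).trans_lt (max_lt hO hA')

end Sizes

/-! ### Universality -/

theorem mainTheorem6 :
    AlgebraicallyUniversal.{u} WGra.{u} ∧
    (∀ κ : Cardinal.{u}, Cardinal.aleph0 ≤ κ → KappaUniversal WGra.{u} κ) ∧
    ((starH.{u}).Full ∧ (starH.{u}).Faithful) ∧
    (∀ κ : Cardinal.{u}, Cardinal.aleph0 ≤ κ → ∀ G : ConGra.{u},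
      sizeLT ConGra.{u} κ G → sizeLT WGra.{u} κ (starH.obj G)) := by
  have := starH_full.{u}
  have := starH_faithful.{u}
  refine ⟨fun Δ _ => ⟨algToConGra Δ ⋙ starH, inferInstance, inferInstance⟩,
    fun κ hκ Δ _ hΔ => ?_, ⟨inferInstance, inferInstance⟩, starH_sizeLT⟩
  exact ⟨(sizeLT WGra.{u} κ).lift ((sizeLT (UAlg Δ) κ).ι ⋙ algToConGra Δ ⋙ starH)
    (fun A => starH_sizeLT κ hκ _ (algToConGra_sizeLT hκ hΔ A.property)),
    inferInstance, inferInstance⟩
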